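/- Let $M$ and $N$ be smooth Riemannian manifolds with $\dim M=n+1$ and $\dim N=n$, and let $\pi:M\to N$ be a Riemannian submersion, that is, a smooth submersion such that $d\pi_x$ is isometric on $(\ker d\pi_x)^{\perp}$ for every $x\in M$. Assume that the geometry of $M$ is locally homogeneous with the full orthogonal group as isotropy group, that is, the local isometries of $M$ act transitively on its orthonormal frames: for all $p,q\in M$ and every linear isometry $L:T_pM\to T_qM$ there is a local isometry $\varphi$ of $M$, defined near $p$, with $\varphi(p)=q$ and $d\varphi_p=L$. Let $\bar e_1,\dots,\bar e_n$ be a smooth orthonormal frame of $N$ on an open set $W\subseteq N$. On an open set $U\subseteq\pi^{-1}(W)$ let $e_1,\dots,e_n$ be the horizontal lifts of $\bar e_1,\dots,\bar e_n$, and let $V$ be a smooth unit vector field tangent to the fibres of $\pi$. With $\nabla$ the Levi-Civita connection of $M$, define the rotation functions $$M_{ij}=\langle\nabla_{e_j}e_i,V\rangle\qquad(1\le i,j\le n)$$ on $U$; if $\theta^1,\dots,\theta^n,\psi$ is the dual coframe of $e_1,\dots,e_n,V$, this says that $\langle\nabla e_i,V\rangle=\sum_j M_{ij}\theta^j+K_i\psi$.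 Then every $M_{ij}$ is constant along each leaf, that is, on every connected subset of a fibre of $\pi|_U$, and is basic for $\pi$: every point of $U$ has an open neighbourhood $U'\subseteq U$ on which $M_{ij}=f\circ\pi$ for a smooth function $f$ on an open subset of $N$ containing $\pi(U')$. -/

import Mathlib

open Bundle Manifold Set
open scoped ContDiff Topology

noncomputable section

/-- `φ` is a local isometry of the Riemannian manifold `M`: a smooth diffeomorphism between the
open subsets `φ.source` and `φ.target` of `M` whose differential preserves the metric. -/
structure IsLocalIsometry {E : Type*} [NormedAddCommGroup E] [NormedSpace ℝ E]
    {H : Type*} [TopologicalSpace H] (I : ModelWithCorners ℝ E H)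
    {M : Type*} [TopologicalSpace M] [ChartedSpace H M]
    [RiemannianBundle (fun x : M => TangentSpace I x)]
    (φ : OpenPartialHomeomorph M M) : Prop where
  contMDiffOn : ContMDiffOn I I ∞ φ φ.source
  contMDiffOn_symm : ContMDiffOn I I ∞ φ.symm φ.target
  inner_mfderiv : ∀ x ∈ φ.source, ∀ v w : TangentSpace I x,
    inner ℝ (mfderiv I I φ x v) (mfderiv I I φ x w) = inner ℝ v w

/-- Local homogeneity of the Riemannian geometry of `M`, with the full orthogonal group as
isotropy group: the local isometries act transitively on the orthonormal frames of `M`. That is,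
every linear isometry from a tangent space of `M` to a tangent space of `M` is the differential of
a local isometry. -/
def IsLocallyHomogeneousGeometry {E : Type*} [NormedAddCommGroup E] [NormedSpace ℝ E]
    {H : Type*} [TopologicalSpace H] (I : ModelWithCorners ℝ E H)
    (M : Type*) [TopologicalSpace M] [ChartedSpace H M]
    [RiemannianBundle (fun x : M => TangentSpace I x)] : Prop :=
  ∀ (p q : M) (L : TangentSpace I p ≃ₗᵢ[ℝ] TangentSpace I q),
    ∃ φ : OpenPartialHomeomorph M M, IsLocalIsometry I φ ∧ p ∈ φ.source ∧
      ∀ v : TangentSpace I p,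
        tangentMap I I φ (⟨p, v⟩ : TangentBundle I M) = (⟨q, L v⟩ : TangentBundle I M)

/-- `pr` is a Riemannian submersion: a smooth submersion whose differential is isometric on the
orthogonal complement of its kernel. -/
structure IsRiemannianSubmersion
    {E : Type*} [NormedAddCommGroup E] [NormedSpace ℝ E]
    {H : Type*} [TopologicalSpace H] (I : ModelWithCorners ℝ E H)
    {F : Type*} [NormedAddCommGroup F] [NormedSpace ℝ F]
    {G : Type*} [TopologicalSpace G] (J : ModelWithCorners ℝ F G)
    {M : Type*} [TopologicalSpace M] [ChartedSpace H M]
    [RiemannianBundle (fun x : M => TangentSpace I x)]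
    {N : Type*} [TopologicalSpace N] [ChartedSpace G N]
    [RiemannianBundle (fun y : N => TangentSpace J y)]
    (pr : M → N) : Prop where
  isSubmersion : IsSubmersion I J ∞ pr
  norm_mfderiv : ∀ (x : M) (v : TangentSpace I x),
    (∀ w : TangentSpace I x, mfderiv I J pr x w = 0 → inner ℝ v w = 0) →
      ‖mfderiv I J pr x v‖ = ‖v‖

/-- A connection on the tangent bundle is the Levi-Civita connection if it is compatible with the
metric and torsion free. (These conditions determine it on differentiable vector fields.) -/
def IsLeviCivita {E : Type*} [NormedAddCommGroup E] [NormedSpace ℝ E] [FiniteDimensional ℝ E]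
    [CompleteSpace E]
    {H : Type*} [TopologicalSpace H] {I : ModelWithCorners ℝ E H}
    {M : Type*} [TopologicalSpace M] [ChartedSpace H M] [IsManifold I ∞ M]
    [RiemannianBundle (fun x : M => TangentSpace I x)]
    [IsContMDiffRiemannianBundle I ∞ E (fun x : M => TangentSpace I x)]
    (cov : CovariantDerivative I E (fun x : M => TangentSpace I x)) : Prop :=
  CovariantDerivative.IsMetricCompatible (V := fun x : M => TangentSpace I x) cov ∧ cov.torsion = 0

/-- A local orthonormal frame `(e₁, …, eₙ, V)` of `M` on the open set `U`, adapted to the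
one-dimensional leaves of `pr : M → N`. The unit field `V` is tangent to the leaves. The fields
`eᵢ` are orthogonal to the leaves and are the lifts of an orthonormal frame `ē` of `N` on the open
set `W ⊇ pr(U)`; equivalently the dual forms `θⁱ` of the `eᵢ` are the pull-backs of the dual forms
of `ē`. -/
structure IsAdaptedFrame {n : ℕ}
    {M : Type*} [TopologicalSpace M] [ChartedSpace (EuclideanSpace ℝ (Fin (n + 1))) M]
    [IsManifold (𝓡 (n + 1)) ∞ M]
    [RiemannianBundle (fun x : M => TangentSpace (𝓡 (n + 1)) x)]
    {N : Type*} [TopologicalSpace N] [ChartedSpace (EuclideanSpace ℝ (Fin n)) N]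
    [IsManifold (𝓡 n) ∞ N]
    [RiemannianBundle (fun y : N => TangentSpace (𝓡 n) y)]
    (pr : M → N) (U : Set M) (W : Set N)
    (ebar : Fin n → (y : N) → TangentSpace (𝓡 n) y)
    (e : Fin n → (x : M) → TangentSpace (𝓡 (n + 1)) x)
    (V : (x : M) → TangentSpace (𝓡 (n + 1)) x) : Prop where
  isOpen_source : IsOpen U
  isOpen_base : IsOpen W
  mapsTo : MapsTo pr U W
  smooth_base : ∀ i, ContMDiffOn (𝓡 n) (𝓡 n).tangent ∞
    (fun y => (⟨y, ebar i y⟩ : TangentBundle (𝓡 n) N)) W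
  orthonormal_base : ∀ y ∈ W, Orthonormal ℝ (fun i => ebar i y)
  smooth_horizontal : ∀ i, ContMDiffOn (𝓡 (n + 1)) (𝓡 (n + 1)).tangent ∞
    (fun x => (⟨x, e i x⟩ : TangentBundle (𝓡 (n + 1)) M)) U
  smooth_vertical : ContMDiffOn (𝓡 (n + 1)) (𝓡 (n + 1)).tangent ∞
    (fun x => (⟨x, V x⟩ : TangentBundle (𝓡 (n + 1)) M)) U
  vertical : ∀ x ∈ U, mfderiv (𝓡 (n + 1)) (𝓡 n) pr x (V x) = 0
  norm_vertical : ∀ x ∈ U, ‖V x‖ = 1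
  horizontal : ∀ x ∈ U, ∀ i, inner ℝ (e i x) (V x) = 0
  lift : ∀ x ∈ U, ∀ i, mfderiv (𝓡 (n + 1)) (𝓡 n) pr x (e i x) = ebar i (pr x)

/-- The rotation functions `M_{ij} = ⟨∇_{e_j} e_i, V⟩`, that is, the coefficient of `θʲ` in the
connection form `β⁰ᵢ = ⟨∇ eᵢ, V⟩ = M_{ij} θʲ + K_i ψ`. -/
def rotationFunction {n : ℕ}
    {M : Type*} [TopologicalSpace M] [ChartedSpace (EuclideanSpace ℝ (Fin (n + 1))) M]
    [IsManifold (𝓡 (n + 1)) ∞ M]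
    [RiemannianBundle (fun x : M => TangentSpace (𝓡 (n + 1)) x)]
    (cov : CovariantDerivative (𝓡 (n + 1)) (EuclideanSpace ℝ (Fin (n + 1)))
      (fun x : M => TangentSpace (𝓡 (n + 1)) x))
    (e : Fin n → (x : M) → TangentSpace (𝓡 (n + 1)) x)
    (V : (x : M) → TangentSpace (𝓡 (n + 1)) x) (i j : Fin n) (x : M) : ℝ :=
  inner ℝ (cov (e i) x (e j x)) (V x)

/-- `f` is constant along the leaves of `pr` in `U`: it is constant on every connected part of
every fibre of `pr` restricted to `U`. -/
def IsConstantAlongLeaves {M N : Type*} [TopologicalSpace M] (pr : M → N) (U : Set M)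
    (f : M → ℝ) : Prop :=
  ∀ (y : N) (S : Set M), S ⊆ U ∩ pr ⁻¹' {y} → IsPreconnected S →
    ∀ x ∈ S, ∀ x' ∈ S, f x = f x'

/-- `f` is basic for `pr` on `U`: near every point of `U` it is the pull-back under `pr` of a
smooth function on an open subset of the base. -/
def IsLocallyBasic {E : Type*} [NormedAddCommGroup E] [NormedSpace ℝ E]
    {H : Type*} [TopologicalSpace H] (J : ModelWithCorners ℝ E H)
    {M N : Type*} [TopologicalSpace M] [TopologicalSpace N] [ChartedSpace H N]
    (pr : M → N) (U : Set M) (f : M → ℝ) : Prop :=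
  ∀ x ∈ U, ∃ (U' : Set M) (W' : Set N) (fbar : N → ℝ),
    IsOpen U' ∧ x ∈ U' ∧ U' ⊆ U ∧ IsOpen W' ∧ MapsTo pr U' W' ∧
    ContMDiffOn J 𝓘(ℝ, ℝ) ∞ fbar W' ∧ ∀ x' ∈ U', f x' = fbar (pr x')

end

set_option linter.unusedSectionVars false

/-! ### Vector fields as derivations of smooth functions -/

section VectorFields

open VectorField

variable {E : Type*} [NormedAddCommGroup E] [NormedSpace ℝ E]
  {H : Type*} [TopologicalSpace H] {I : ModelWithCorners ℝ E H}
  {M : Type*} [TopologicalSpace M] [ChartedSpace H M]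

/-! The rotation functions are the O'Neill tensor of the submersion. A vertical field is
`pr`-related to zero, so `[eᵢ, V]` is vertical, and the Koszul formula reduces to `M_{ij} = ½⟨[e_j,
e_i], V⟩` (`IsAdaptedFrame.rotationFunction_eq`). The brackets of the `eᵢ` have the same horizontal
components as those of the `ēᵢ`, hence O'Neill's formula `sec_M(eᵢ, e_j) = sec_N(ēᵢ, ē_j) ∘ pr - 3
M_{ij}²` (`IsAdaptedFrame.frameCurvature_eq`).

A local isometry carries the adapted frame at one point of `U` to the adapted frame at any other, so
`sec_M(eᵢ, e_j)` is constant on `U` (`IsLocallyHomogeneousGeometry.frameCurvature_eq`). Therefore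
`M_{ij}²` depends only on `pr x`. A continuous function whose square is constant on a connected set
is constant there, which gives constancy along the leaves. The normal form of a submersion then
exhibits the smooth, leafwise constant `M_{ij}` as a pull-back from the base
(`IsConstantAlongLeaves.isLocallyBasic`).

Curvature is computed in an orthonormal frame from its structure functions `⟨[E_a, E_b], E_c⟩` and
their derivatives. In this form naturality under isometries and comparison with the base are both
chain rules. What remains is that the result depends only on the frame at the point, which follows
from the symmetries of the Riemann tensor. -/

theorem mvfderiv_congr_of_eventuallyEq {f g : M → ℝ} {x : M} (h : f =ᶠ[𝓝 x] g) :
    mvfderiv I f x = mvfderiv I g x := by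
  unfold mvfderiv
  rw [h.mfderiv_eq]
  rfl

variable [IsManifold I ∞ M]

/-- The derivative of a smooth function along a smooth vector field is smooth. -/
theorem ContMDiffOn.mvfderiv_apply {U : Set M} (hU : IsOpen U) {f : M → ℝ}
    (hf : ContMDiffOn I 𝓘(ℝ, ℝ) ∞ f U) {X : Π x : M, TangentSpace I x}
    (hX : ContMDiffOn I I.tangent ∞ (fun x => (⟨x, X x⟩ : TangentBundle I M)) U) :
    ContMDiffOn I 𝓘(ℝ, ℝ) ∞ (fun x => mvfderiv I f x (X x)) U := by
  have h1 : ContMDiffOn I.tangent 𝓘(ℝ, ℝ).tangent ∞ (tangentMapWithin I 𝓘(ℝ, ℝ) f U)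
      (π E (TangentSpace I) ⁻¹' U) :=
    hf.contMDiffOn_tangentMapWithin (by simp) hU.uniqueMDiffOn
  have h2 := h1.comp hX (fun x hx => hx)
  have h3 := (contMDiff_snd_tangentBundle_modelSpace ℝ 𝓘(ℝ, ℝ) (n := ∞)).comp_contMDiffOn h2
  refine h3.congr fun x hx => ?_
  simp only [Function.comp, tangentMapWithin, mfderivWithin_of_isOpen hU hx]
  rfl

section

variable [CompleteSpace E]

theorem ContMDiffOn.mlieBracket_of_isOpen {U : Set M} (hU : IsOpen U)
    {X Y : Π x : M, TangentSpace I x}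
    (hX : ContMDiffOn I I.tangent ∞ (fun x => (⟨x, X x⟩ : TangentBundle I M)) U)
    (hY : ContMDiffOn I I.tangent ∞ (fun x => (⟨x, Y x⟩ : TangentBundle I M)) U) :
    ContMDiffOn I I.tangent ∞ (fun x => (⟨x, mlieBracket I X Y x⟩ : TangentBundle I M)) U := by
  intro x hx
  have : IsManifold I (minSmoothness ℝ 2) M := by
    rw [minSmoothness_of_isRCLikeNormedField]; infer_instance
  have : IsManifold I (((⊤ : ℕ∞) : ℕ∞ω) + 1) M := ‹IsManifold I ∞ M›
  exact (ContMDiffAt.mlieBracket_vectorField (m := ⊤) (n := ⊤)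
    (hX.contMDiffAt (hU.mem_nhds hx)) (hY.contMDiffAt (hU.mem_nhds hx)) (by simp)).contMDiffWithinAt

/-- The Lie bracket acts on functions as the commutator of derivations. The auxiliary field `Z`
only serves to know that the tangent space at `x` is nontrivial. -/
theorem mvfderiv_mlieBracket {U : Set M} (hU : IsOpen U) {f : M → ℝ}
    (hf : ContMDiffOn I 𝓘(ℝ, ℝ) ∞ f U) {X Y Z : Π x : M, TangentSpace I x}
    (hX : ContMDiffOn I I.tangent ∞ (fun x => (⟨x, X x⟩ : TangentBundle I M)) U)
    (hY : ContMDiffOn I I.tangent ∞ (fun x => (⟨x, Y x⟩ : TangentBundle I M)) U)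
    (hZ : ContMDiffOn I I.tangent ∞ (fun x => (⟨x, Z x⟩ : TangentBundle I M)) U)
    {x : M} (hx : x ∈ U) (hZx : Z x ≠ 0) :
    mvfderiv I f x (mlieBracket I X Y x) =
      mvfderiv I (fun y => mvfderiv I f y (Y y)) x (X x) -
        mvfderiv I (fun y => mvfderiv I f y (X y)) x (Y x) := by
  have hnhds : ∀ {y}, y ∈ U → U ∈ 𝓝 y := fun hy => hU.mem_nhds hy
  have md : ∀ {W : Π x : M, TangentSpace I x},
      ContMDiffOn I I.tangent ∞ (fun x => (⟨x, W x⟩ : TangentBundle I M)) U →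
      ∀ y ∈ U, MDifferentiableAt I I.tangent (fun x => (⟨x, W x⟩ : TangentBundle I M)) y :=
    fun hW y hy => (hW.contMDiffAt (hnhds hy)).mdifferentiableAt (by simp)
  have mf : ∀ {g : M → ℝ}, ContMDiffOn I 𝓘(ℝ, ℝ) ∞ g U →
      ∀ y ∈ U, MDifferentiableAt I 𝓘(ℝ, ℝ) g y :=
    fun hg y hy => (hg.contMDiffAt (hnhds hy)).mdifferentiableAt (by simp)
  have c2 : ∀ {W : Π x : M, TangentSpace I x},
      ContMDiffOn I I.tangent ∞ (fun x => (⟨x, W x⟩ : TangentBundle I M)) U →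
      ContMDiffAt I I.tangent (minSmoothness ℝ 2)
        (fun x => (⟨x, W x⟩ : TangentBundle I M)) x :=
    fun hW => (hW.contMDiffAt (hnhds hx)).of_le (by
      rw [minSmoothness_of_isRCLikeNormedField]
      exact ENat.LEInfty.out)
  have smul : ∀ {g : M → ℝ} {W : Π x : M, TangentSpace I x}, ContMDiffOn I 𝓘(ℝ, ℝ) ∞ g U →
      ContMDiffOn I I.tangent ∞ (fun x => (⟨x, W x⟩ : TangentBundle I M)) U →
      ContMDiffOn I I.tangent ∞ (fun x => (⟨x, (g • W) x⟩ : TangentBundle I M)) U :=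
    fun hg hW => hg.smul_section hW
  have key : ∀ {A B : Π x : M, TangentSpace I x},
      ContMDiffOn I I.tangent ∞ (fun x => (⟨x, A x⟩ : TangentBundle I M)) U →
      ContMDiffOn I I.tangent ∞ (fun x => (⟨x, B x⟩ : TangentBundle I M)) U →
      mlieBracket I A (mlieBracket I B (f • Z)) x =
        (mvfderiv I (fun y => mvfderiv I f y (B y)) x (A x) • Z x +
          mvfderiv I f x (B x) • mlieBracket I A Z x) +
        (mvfderiv I f x (A x) • mlieBracket I B Z x +
          f x • mlieBracket I A (mlieBracket I B Z) x) := by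
    intro A B hA hB
    have e1 : mlieBracket I B (f • Z) =ᶠ[𝓝 x]
        ((fun y => mvfderiv I f y (B y)) • Z) + f • mlieBracket I B Z := by
      filter_upwards [hnhds hx] with y hy
      exact mlieBracket_smul_right (mf hf y hy) (md hZ y hy)
    have h1 := hf.mvfderiv_apply hU hB
    have h2 := hB.mlieBracket_of_isOpen hU hZ
    rw [Filter.EventuallyEq.rfl.mlieBracket_vectorField_eq e1,
      mlieBracket_add_right (md (smul h1 hZ) x hx) (md (smul hf h2) x hx),
      mlieBracket_smul_right (mf h1 x hx) (md hZ x hx),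
      mlieBracket_smul_right (mf hf x hx) (md h2 x hx)]
  have : IsManifold I (minSmoothness ℝ 3) M := by
    rw [minSmoothness_of_isRCLikeNormedField]
    exact IsManifold.of_le (n := ∞) ENat.LEInfty.out
  -- Compare the Jacobi identity for `X, Y, f • Z` with that for `X, Y, Z`. The terms with one
  -- derivative of `f` in each of the directions `X`, `Y` cancel, leaving the commutator defect on
  -- `f` times `Z x`.
  have h := leibniz_identity_mlieBracket_apply (c2 hX) (c2 hY) (c2 (smul hf hZ))
  have h' := leibniz_identity_mlieBracket_apply (c2 hX) (c2 hY) (c2 hZ)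
  rw [key hX hY, key hY hX, mlieBracket_smul_right (mf hf x hx) (md hZ x hx), h'] at h
  have h3 : (mvfderiv I f x (mlieBracket I X Y x) -
      (mvfderiv I (fun y => mvfderiv I f y (Y y)) x (X x) -
        mvfderiv I (fun y => mvfderiv I f y (X y)) x (Y x))) • Z x = 0 := by
    rw [← sub_eq_zero] at h
    rw [← neg_eq_zero, ← h]
    module
  exact sub_eq_zero.1 ((smul_eq_zero.1 h3).resolve_right hZx)

end

/-- The linear functionals of the extended chart separate tangent vectors. -/
theorem eq_of_mvfderiv_eq [FiniteDimensional ℝ E] {x : M} {v w : TangentSpace I x}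
    (h : ∀ l : E →L[ℝ] ℝ, mvfderiv I (l ∘ extChartAt I x) x v =
      mvfderiv I (l ∘ extChartAt I x) x w) : v = w := by
  have hc : MDifferentiableAt I 𝓘(ℝ, E) (extChartAt I x) x :=
    mdifferentiableAt_extChartAt (mem_chart_source H x)
  have h1 : ∀ (l : E →L[ℝ] ℝ) (u : TangentSpace I x),
      mvfderiv I (l ∘ extChartAt I x) x u = l (mfderiv I 𝓘(ℝ, E) (extChartAt I x) x u) := by
    intro l u
    have := mfderiv_comp_apply x (l.mdifferentiableAt (x := extChartAt I x x)) hc u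
    unfold mvfderiv
    rw [l.mfderiv_eq] at this
    exact this
  have hinj := (isInvertible_mfderiv_extChartAt (I := I) (mem_extChartAt_source x)).injective
  have hE : ∀ a b : E, (∀ l : E →L[ℝ] ℝ, l a = l b) → a = b :=
    fun a b => (SeparatingDual.eq_iff_forall_dual_eq (R := ℝ)).2
  exact hinj (hE _ _ fun l => by rw [← h1, ← h1, h])

end VectorFields

/-! ### Brackets of related vector fields -/

section RelatedFields

open VectorField

variable {E : Type*} [NormedAddCommGroup E] [NormedSpace ℝ E] [CompleteSpace E]
  {H : Type*} [TopologicalSpace H] {I : ModelWithCorners ℝ E H}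
  {M : Type*} [TopologicalSpace M] [ChartedSpace H M] [IsManifold I ∞ M]
  {F : Type*} [NormedAddCommGroup F] [NormedSpace ℝ F] [FiniteDimensional ℝ F]
  {G : Type*} [TopologicalSpace G] {J : ModelWithCorners ℝ F G}
  {N : Type*} [TopologicalSpace N] [ChartedSpace G N] [IsManifold J ∞ N]

/-- If the fields `X`, `Y` are `p`-related to `X'`, `Y'`, then `[X, Y]` is `p`-related to
`[X', Y']`. -/
theorem mfderiv_mlieBracket_of_related {U : Set M} {W : Set N} (hU : IsOpen U) (hW : IsOpen W)
    {p : M → N} (hp : CMDiff[U] ∞ p) (hUW : MapsTo p U W)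
    {X Y Z : Π x : M, TangentSpace I x} {X' Y' Z' : Π y : N, TangentSpace J y}
    (hX : CMDiff[U] ∞ (T% X)) (hY : CMDiff[U] ∞ (T% Y)) (hZ : CMDiff[U] ∞ (T% Z))
    (hX' : CMDiff[W] ∞ (T% X')) (hY' : CMDiff[W] ∞ (T% Y')) (hZ' : CMDiff[W] ∞ (T% Z'))
    (hXX' : ∀ x ∈ U, mfderiv I J p x (X x) = X' (p x))
    (hYY' : ∀ x ∈ U, mfderiv I J p x (Y x) = Y' (p x))
    {x : M} (hx : x ∈ U) (hZx : Z x ≠ 0) (hZx' : Z' (p x) ≠ 0) :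
    mfderiv I J p x (mlieBracket I X Y x) = mlieBracket J X' Y' (p x) := by
  have : CompleteSpace F := FiniteDimensional.complete ℝ F
  refine eq_of_mvfderiv_eq fun l => ?_
  -- It suffices to test on coordinate functions. These are smooth only on the chart domain, so `W`
  -- and `U` are shrunk to `W₁` and `U₁`.
  set f : N → ℝ := l ∘ extChartAt J (p x) with hf_def
  set W₁ := W ∩ (chartAt G (p x)).source with hW₁
  have hW₁o : IsOpen W₁ := hW.inter (chartAt G (p x)).open_source
  set U₁ := U ∩ p ⁻¹' W₁ with hU₁
  have hU₁o : IsOpen U₁ := hp.continuousOn.isOpen_inter_preimage hU hW₁o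
  have hxW : p x ∈ W₁ := ⟨hUW hx, mem_chart_source G (p x)⟩
  have hxU : x ∈ U₁ := ⟨hx, hxW⟩
  have hWsub : W₁ ⊆ W := inter_subset_left
  have hUsub : U₁ ⊆ U := inter_subset_left
  have hf : CMDiff[W₁] ∞ f :=
    l.contMDiff.comp_contMDiffOn
      ((contMDiffOn_extChartAt (I := J) (x := p x) (n := ∞)).mono inter_subset_right)
  have hfp : CMDiff[U₁] ∞ (f ∘ p) := hf.comp (hp.mono hUsub) fun y hy => hy.2
  have md : ∀ {g : N → ℝ}, CMDiff[W₁] ∞ g → ∀ y ∈ W₁, MDifferentiableAt J 𝓘(ℝ, ℝ) g y :=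
    fun hg y hy => (hg.contMDiffAt (hW₁o.mem_nhds hy)).mdifferentiableAt (by simp)
  have mp : ∀ y ∈ U, MDifferentiableAt I J p y :=
    fun y hy => (hp.contMDiffAt (hU.mem_nhds hy)).mdifferentiableAt (by simp)
  have chain : ∀ {g : N → ℝ}, CMDiff[W₁] ∞ g → ∀ y ∈ U₁, ∀ v : TangentSpace I y,
      mvfderiv I (g ∘ p) y v = mvfderiv J g (p y) (mfderiv I J p y v) :=
    fun hg y hy v => mvfderiv_comp_apply y (md hg _ hy.2) (mp y hy.1) v
  have step : ∀ {A : Π x : M, TangentSpace I x} {A' : Π y : N, TangentSpace J y},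
      (∀ x ∈ U, mfderiv I J p x (A x) = A' (p x)) →
      (fun y => mvfderiv I (f ∘ p) y (A y)) =ᶠ[𝓝 x] (fun z => mvfderiv J f z (A' z)) ∘ p := by
    intro A A' hA
    filter_upwards [hU₁o.mem_nhds hxU] with y hy
    rw [chain hf y hy, hA y hy.1]
    rfl
  rw [← chain hf x hxU, mvfderiv_mlieBracket hU₁o hfp (hX.mono hUsub) (hY.mono hUsub)
      (hZ.mono hUsub) hxU hZx,
    mvfderiv_mlieBracket hW₁o hf (hX'.mono hWsub) (hY'.mono hWsub) (hZ'.mono hWsub) hxW hZx',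
    mvfderiv_congr_of_eventuallyEq (step hXX'), mvfderiv_congr_of_eventuallyEq (step hYY'),
    chain (hf.mvfderiv_apply hW₁o (hX'.mono hWsub)) x hxU,
    chain (hf.mvfderiv_apply hW₁o (hY'.mono hWsub)) x hxU, hXX' x hx, hYY' x hx]

end RelatedFields

/-! ### Smoothness of fields and of their inner products -/

section SmoothFields

variable {E : Type*} [NormedAddCommGroup E] [NormedSpace ℝ E]
  {H : Type*} [TopologicalSpace H] {I : ModelWithCorners ℝ E H}
  {M : Type*} [TopologicalSpace M] [ChartedSpace H M] [IsManifold I ∞ M]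

theorem ContMDiffOn.mdifferentiableAt_of_isOpen {U : Set M} (hU : IsOpen U)
    {X : Π x : M, TangentSpace I x} (hX : CMDiff[U] ∞ (T% X)) {x : M} (hx : x ∈ U) :
    MDiffAt (T% X) x :=
  (hX.contMDiffAt (hU.mem_nhds hx)).mdifferentiableAt (by simp)

theorem ContMDiffOn.inner_tangent [RiemannianBundle (fun x : M => TangentSpace I x)]
    [IsContMDiffRiemannianBundle I ∞ E (fun x : M => TangentSpace I x)] {U : Set M}
    {X Y : Π x : M, TangentSpace I x} (hX : CMDiff[U] ∞ (T% X)) (hY : CMDiff[U] ∞ (T% Y)) :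
    CMDiff[U] ∞ (fun x => (inner ℝ (X x) (Y x) : ℝ)) :=
  ContMDiffOn.inner_bundle (F := E) (E := fun x : M => TangentSpace I x) hX hY

end SmoothFields

/-! ### The Levi-Civita connection and the Koszul formula -/

noncomputable section LeviCivita

open VectorField

variable {E : Type*} [NormedAddCommGroup E] [NormedSpace ℝ E] [FiniteDimensional ℝ E]
  [CompleteSpace E]
  {H : Type*} [TopologicalSpace H] {I : ModelWithCorners ℝ E H}
  {M : Type*} [TopologicalSpace M] [ChartedSpace H M] [IsManifold I ∞ M]
  [RiemannianBundle (fun x : M => TangentSpace I x)]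
  [IsContMDiffRiemannianBundle I ∞ E (fun x : M => TangentSpace I x)]
  {cov : CovariantDerivative I E (fun x : M => TangentSpace I x)}

theorem IsLeviCivita.mvfderiv_inner (hcov : IsLeviCivita cov) {x : M} (v : TangentSpace I x)
    {Y Z : Π x : M, TangentSpace I x} (hY : MDiffAt (T% Y) x) (hZ : MDiffAt (T% Z) x) :
    mvfderiv I (fun y => inner ℝ (Y y) (Z y)) x v =
      inner ℝ (cov Y x v) (Z x) + inner ℝ (Y x) (cov Z x v) := by
  -- Compatibility is stated for a field as direction; any field through `v` gives the version for a
  -- single vector.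
  have h := CovariantDerivative.IsMetricCompatible.mvfderiv_inner_eq
    (V := fun x : M => TangentSpace I x) hcov.1 (fun y => FiberBundle.extend E v y) hY hZ
  simpa only [FiberBundle.extend_apply_self] using h

theorem IsLeviCivita.torsion_eq (hcov : IsLeviCivita cov) {x : M}
    {X Y : Π x : M, TangentSpace I x} (hX : MDiffAt (T% X) x) (hY : MDiffAt (T% Y) x) :
    mlieBracket I X Y x = cov Y x (X x) - cov X x (Y x) :=
  (cov.torsion_eq_zero_iff.1 hcov.2 hX hY).symm

/-- The Koszul formula. -/
theorem IsLeviCivita.koszul (hcov : IsLeviCivita cov) {x : M}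
    {X Y Z : Π x : M, TangentSpace I x} (hX : MDiffAt (T% X) x) (hY : MDiffAt (T% Y) x)
    (hZ : MDiffAt (T% Z) x) :
    inner ℝ (cov Y x (X x)) (Z x) = (1 / 2 : ℝ) *
      (mvfderiv I (fun y => inner ℝ (Y y) (Z y)) x (X x) +
        mvfderiv I (fun y => inner ℝ (X y) (Z y)) x (Y x) -
        mvfderiv I (fun y => inner ℝ (X y) (Y y)) x (Z x) +
        inner ℝ (mlieBracket I X Y x) (Z x) - inner ℝ (mlieBracket I X Z x) (Y x) -
        inner ℝ (mlieBracket I Y Z x) (X x)) := by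
  rw [hcov.mvfderiv_inner _ hY hZ, hcov.mvfderiv_inner _ hX hZ, hcov.mvfderiv_inner _ hX hY,
    hcov.torsion_eq hX hY, hcov.torsion_eq hX hZ, hcov.torsion_eq hY hZ]
  simp only [inner_sub_left]
  rw [real_inner_comm (cov Z x (X x)), real_inner_comm (cov Z x (Y x)),
    real_inner_comm (cov Y x (Z x))]
  ring

/-- Smoothness of `cov` is not part of `IsLeviCivita`; it comes from the Koszul formula, whose
right-hand side is smooth. -/
theorem IsLeviCivita.contMDiffOn_inner_cov (hcov : IsLeviCivita cov) {U : Set M} (hU : IsOpen U)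
    {X Y Z : Π x : M, TangentSpace I x} (hX : CMDiff[U] ∞ (T% X)) (hY : CMDiff[U] ∞ (T% Y))
    (hZ : CMDiff[U] ∞ (T% Z)) :
    CMDiff[U] ∞ (fun x => inner ℝ (cov Y x (X x)) (Z x)) := by
  have hd : ∀ {A B C : Π x : M, TangentSpace I x}, CMDiff[U] ∞ (T% A) → CMDiff[U] ∞ (T% B) →
      CMDiff[U] ∞ (T% C) →
      CMDiff[U] ∞ (fun x => mvfderiv I (fun y => inner ℝ (A y) (B y)) x (C x)) :=
    fun hA hB hC => (hA.inner_tangent hB).mvfderiv_apply hU hC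
  have hb : ∀ {A B C : Π x : M, TangentSpace I x}, CMDiff[U] ∞ (T% A) → CMDiff[U] ∞ (T% B) →
      CMDiff[U] ∞ (T% C) →
      CMDiff[U] ∞ (fun x => inner ℝ (mlieBracket I A B x) (C x)) :=
    fun hA hB hC => (hA.mlieBracket_of_isOpen hU hB).inner_tangent hC
  have h := (contMDiffOn_const (c := (1 / 2 : ℝ))).mul
    ((((((hd hY hZ hX).add (hd hX hZ hY)).sub (hd hX hY hZ)).add (hb hX hY hZ)).sub
      (hb hX hZ hY)).sub (hb hY hZ hX))
  exact h.congr fun x hx => hcov.koszul (hX.mdifferentiableAt_of_isOpen hU hx)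
    (hY.mdifferentiableAt_of_isOpen hU hx) (hZ.mdifferentiableAt_of_isOpen hU hx)

/-- A smooth orthonormal frame of the tangent bundle on the open set `U`. -/
structure IsOrthonormalFrameOn {ι : Type*} [Fintype ι] (E₀ : ι → Π x : M, TangentSpace I x)
    (U : Set M) : Prop where
  isOpen : IsOpen U
  smooth : ∀ a, CMDiff[U] ∞ (T% (E₀ a))
  orthonormal : ∀ x ∈ U, Orthonormal ℝ fun a => E₀ a x
  sum_inner_smul : ∀ x ∈ U, ∀ v : TangentSpace I x, ∑ a, (inner ℝ (E₀ a x) v : ℝ) • E₀ a x = v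

/-- The curvature operator `R(X, Y) Z = ∇_X ∇_Y Z - ∇_Y ∇_X Z - ∇_{[X, Y]} Z`. -/
def CovariantDerivative.curvature (cov : CovariantDerivative I E (fun x : M => TangentSpace I x))
    (X Y Z : Π x : M, TangentSpace I x) (x : M) : TangentSpace I x :=
  cov (fun y => cov Z y (Y y)) x (X x) - cov (fun y => cov Z y (X y)) x (Y x) -
    cov Z x (mlieBracket I X Y x)

end LeviCivita

/-! ### Symmetries of curvature and its expression in an orthonormal frame -/

noncomputable section Curvature

open VectorField

variable {E : Type*} [NormedAddCommGroup E] [NormedSpace ℝ E] [FiniteDimensional ℝ E]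
  [CompleteSpace E]
  {H : Type*} [TopologicalSpace H] {I : ModelWithCorners ℝ E H}
  {M : Type*} [TopologicalSpace M] [ChartedSpace H M] [IsManifold I ∞ M]
  [RiemannianBundle (fun x : M => TangentSpace I x)]
  [IsContMDiffRiemannianBundle I ∞ E (fun x : M => TangentSpace I x)]
  {cov : CovariantDerivative I E (fun x : M => TangentSpace I x)}
  {ι : Type*} [Fintype ι] {E₀ : ι → Π x : M, TangentSpace I x} {U : Set M}

theorem IsOrthonormalFrameOn.inner_eq_sum (hE : IsOrthonormalFrameOn E₀ U) {x : M} (hx : x ∈ U)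
    (v w : TangentSpace I x) :
    (inner ℝ v w : ℝ) = ∑ a, inner ℝ v (E₀ a x) * inner ℝ w (E₀ a x) := by
  conv_lhs => rw [← hE.sum_inner_smul x hx w, inner_sum]
  refine Finset.sum_congr rfl fun a _ => ?_
  rw [inner_smul_right, real_inner_comm w, mul_comm]

theorem IsOrthonormalFrameOn.ne_zero (hE : IsOrthonormalFrameOn E₀ U) {x : M} (hx : x ∈ U)
    (a : ι) : E₀ a x ≠ 0 := by
  intro h
  have := (hE.orthonormal x hx).1 a
  simp only [h, norm_zero] at this
  exact zero_ne_one this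

theorem IsOrthonormalFrameOn.mvfderiv_inner (hE : IsOrthonormalFrameOn E₀ U) {x : M} (hx : x ∈ U)
    (a b : ι) : mvfderiv I (fun y => (inner ℝ (E₀ a y) (E₀ b y) : ℝ)) x = 0 := by
  classical
  have h : (fun y => (inner ℝ (E₀ a y) (E₀ b y) : ℝ)) =ᶠ[𝓝 x]
      fun _ => if a = b then (1 : ℝ) else 0 := by
    filter_upwards [hE.isOpen.mem_nhds hx] with y hy
    exact (orthonormal_iff_ite.1 (hE.orthonormal y hy)) a b
  rw [mvfderiv_congr_of_eventuallyEq h, mvfderiv_const]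

theorem IsLeviCivita.contMDiffOn_cov (hcov : IsLeviCivita cov) (hE : IsOrthonormalFrameOn E₀ U)
    {X Y : Π x : M, TangentSpace I x} (hX : CMDiff[U] ∞ (T% X)) (hY : CMDiff[U] ∞ (T% Y)) :
    CMDiff[U] ∞ (T% (fun x => cov Y x (X x))) := by
  have h : CMDiff[U] ∞ (T% (fun x => ∑ a, (inner ℝ (cov Y x (X x)) (E₀ a x) : ℝ) • E₀ a x)) :=
    ContMDiffOn.sum_section fun a _ =>
      (hcov.contMDiffOn_inner_cov hE.isOpen hX hY (hE.smooth a)).smul_section (hE.smooth a)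
  refine h.congr fun x hx => ?_
  congr 1
  conv_lhs => rw [← hE.sum_inner_smul x hx (cov Y x (X x))]
  exact Finset.sum_congr rfl fun a _ => by rw [real_inner_comm]

theorem CovariantDerivative.curvature_swap (X Y Z : Π x : M, TangentSpace I x) (x : M) :
    cov.curvature X Y Z x = -cov.curvature Y X Z x := by
  simp only [CovariantDerivative.curvature]
  rw [mlieBracket_swap_apply, map_neg]
  abel

/-- The curvature operator of the Levi-Civita connection is skew-symmetric. -/
theorem IsLeviCivita.inner_curvature_swap [Nonempty ι] (hcov : IsLeviCivita cov)
    (hE : IsOrthonormalFrameOn E₀ U) {X Y Z T : Π x : M, TangentSpace I x}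
    (hX : CMDiff[U] ∞ (T% X)) (hY : CMDiff[U] ∞ (T% Y)) (hZ : CMDiff[U] ∞ (T% Z))
    (hT : CMDiff[U] ∞ (T% T)) {x : M} (hx : x ∈ U) :
    (inner ℝ (cov.curvature X Y Z x) (T x) : ℝ) = -inner ℝ (cov.curvature X Y T x) (Z x) := by
  have hU := hE.isOpen
  have md : ∀ {W : Π x : M, TangentSpace I x}, CMDiff[U] ∞ (T% W) → ∀ y ∈ U, MDiffAt (T% W) y :=
    fun hW y hy => hW.mdifferentiableAt_of_isOpen hU hy
  have second : ∀ {A B : Π x : M, TangentSpace I x}, CMDiff[U] ∞ (T% A) → CMDiff[U] ∞ (T% B) →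
      mvfderiv I (fun y => mvfderiv I (fun z => (inner ℝ (Z z) (T z) : ℝ)) y (B y)) x (A x) =
        inner ℝ (cov (fun y => cov Z y (B y)) x (A x)) (T x) +
        inner ℝ (cov Z x (B x)) (cov T x (A x)) + (inner ℝ (cov Z x (A x)) (cov T x (B x)) +
        inner ℝ (Z x) (cov (fun y => cov T y (B y)) x (A x))) := by
    intro A B hA hB
    have h1 : (fun y => mvfderiv I (fun z => (inner ℝ (Z z) (T z) : ℝ)) y (B y)) =ᶠ[𝓝 x]
        (fun y => (inner ℝ (cov Z y (B y)) (T y) : ℝ)) + fun y => inner ℝ (Z y) (cov T y (B y)) := by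
      filter_upwards [hU.mem_nhds hx] with y hy
      exact hcov.mvfderiv_inner _ (md hZ y hy) (md hT y hy)
    have cZ := hcov.contMDiffOn_cov hE hB hZ
    have cT := hcov.contMDiffOn_cov hE hB hT
    rw [mvfderiv_congr_of_eventuallyEq h1, mvfderiv_add
      (((cZ.inner_tangent hT).contMDiffAt (hU.mem_nhds hx)).mdifferentiableAt (by simp))
      (((hZ.inner_tangent cT).contMDiffAt (hU.mem_nhds hx)).mdifferentiableAt (by simp)),
      add_apply, hcov.mvfderiv_inner _ (md cZ x hx) (md hT x hx),
      hcov.mvfderiv_inner _ (md hZ x hx) (md cT x hx)]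
  obtain ⟨a⟩ := ‹Nonempty ι›
  -- Apply `[X, Y] = XY - YX` to the function `⟨Z, T⟩`; the products `⟨∇Z, ∇T⟩` are symmetric in
  -- `X`, `Y` and cancel.
  have h := mvfderiv_mlieBracket hU (hZ.inner_tangent hT) hX hY (hE.smooth a) hx (hE.ne_zero hx a)
  rw [second hX hY, second hY hX, hcov.mvfderiv_inner _ (md hZ x hx) (md hT x hx)] at h
  simp only [CovariantDerivative.curvature, inner_sub_left]
  rw [real_inner_comm (Z x), real_inner_comm (Z x), real_inner_comm (Z x)]
  linarith

/-- The first Bianchi identity. -/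
theorem IsLeviCivita.curvature_bianchi (hcov : IsLeviCivita cov)
    (hE : IsOrthonormalFrameOn E₀ U) {X Y Z : Π x : M, TangentSpace I x}
    (hX : CMDiff[U] ∞ (T% X)) (hY : CMDiff[U] ∞ (T% Y)) (hZ : CMDiff[U] ∞ (T% Z))
    {x : M} (hx : x ∈ U) :
    cov.curvature X Y Z x + cov.curvature Y Z X x + cov.curvature Z X Y x = 0 := by
  have hU := hE.isOpen
  have md : ∀ {W : Π x : M, TangentSpace I x}, CMDiff[U] ∞ (T% W) → ∀ y ∈ U, MDiffAt (T% W) y :=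
    fun hW y hy => hW.mdifferentiableAt_of_isOpen hU hy
  have c2 : ∀ {W : Π x : M, TangentSpace I x}, CMDiff[U] ∞ (T% W) →
      ContMDiffAt I I.tangent (minSmoothness ℝ 2) (T% W) x :=
    fun hW => (hW.contMDiffAt (hU.mem_nhds hx)).of_le (by
      rw [minSmoothness_of_isRCLikeNormedField]; exact ENat.LEInfty.out)
  have comm : ∀ {A B : Π x : M, TangentSpace I x}, CMDiff[U] ∞ (T% A) → CMDiff[U] ∞ (T% B) →
      cov (fun y => cov B y (A y)) x = cov (fun y => cov A y (B y)) x +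
        cov (mlieBracket I A B) x := by
    intro A B hA hB
    have h1 := md (hcov.contMDiffOn_cov hE hA hB) x hx
    have h2 := md (hcov.contMDiffOn_cov hE hB hA) x hx
    have h3 := md (hA.mlieBracket_of_isOpen hU hB) x hx
    rw [← cov.isCovariantDerivativeOn.add h2 h3]
    refine cov.isCovariantDerivativeOn.congr_of_eventuallyEq h1
      (mdifferentiableAt_add_section h2 h3) Filter.univ_mem ?_
    filter_upwards [hU.mem_nhds hx] with y hy
    rw [Pi.add_apply, hcov.torsion_eq (md hA y hy) (md hB y hy)]
    abel
  have : IsManifold I (minSmoothness ℝ 3) M := by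
    rw [minSmoothness_of_isRCLikeNormedField]
    exact IsManifold.of_le (n := ∞) ENat.LEInfty.out
  -- With zero torsion, the Bianchi identity is the Jacobi identity with every bracket written
  -- through `∇`.
  have hj := leibniz_identity_mlieBracket_apply (c2 hX) (c2 hY) (c2 hZ)
  rw [hcov.torsion_eq (md hX x hx) (md (hY.mlieBracket_of_isOpen hU hZ) x hx),
    hcov.torsion_eq (md hY x hx) (md (hX.mlieBracket_of_isOpen hU hZ) x hx),
    hcov.torsion_eq (md (hX.mlieBracket_of_isOpen hU hY) x hx) (md hZ x hx)] at hj
  simp only [CovariantDerivative.curvature]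
  rw [comm hY hZ, comm hX hZ, comm hX hY, mlieBracket_swap_apply (V := Z) (W := X)]
  simp only [add_apply, map_neg]
  rw [← sub_eq_zero] at hj
  rw [← hj]
  abel

/-- The pair symmetry of the Riemann curvature tensor. -/
theorem IsLeviCivita.inner_curvature_pair_symm [Nonempty ι] (hcov : IsLeviCivita cov)
    (hE : IsOrthonormalFrameOn E₀ U) {X Y Z T : Π x : M, TangentSpace I x}
    (hX : CMDiff[U] ∞ (T% X)) (hY : CMDiff[U] ∞ (T% Y)) (hZ : CMDiff[U] ∞ (T% Z))
    (hT : CMDiff[U] ∞ (T% T)) {x : M} (hx : x ∈ U) :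
    (inner ℝ (cov.curvature X Y Z x) (T x) : ℝ) = inner ℝ (cov.curvature Z T X x) (Y x) := by
  have s1 : ∀ A B C D : Π x : M, TangentSpace I x,
      (inner ℝ (cov.curvature A B C x) (D x) : ℝ) = -inner ℝ (cov.curvature B A C x) (D x) := by
    intro A B C D
    rw [CovariantDerivative.curvature_swap, inner_neg_left]
  have b : ∀ {A B C : Π x : M, TangentSpace I x} (D : Π x : M, TangentSpace I x),
      CMDiff[U] ∞ (T% A) → CMDiff[U] ∞ (T% B) → CMDiff[U] ∞ (T% C) →
      (inner ℝ (cov.curvature A B C x) (D x) : ℝ) + inner ℝ (cov.curvature B C A x) (D x) +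
        inner ℝ (cov.curvature C A B x) (D x) = 0 := by
    intro A B C D hA hB hC
    rw [← inner_add_left, ← inner_add_left, hcov.curvature_bianchi hE hA hB hC hx, inner_zero_left]
  -- The classical octahedron argument: the four Bianchi identities, one for each omitted field,
  -- combine linearly with the skew-symmetries.
  have b1 := b T hX hY hZ
  have b2 := b X hY hZ hT
  have b3 := b Y hZ hT hX
  have b4 := b Z hT hX hY
  have t1 := hcov.inner_curvature_swap hE hX hY hZ hT hx
  have t2 := hcov.inner_curvature_swap hE hY hZ hX hT hx
  have t3 := hcov.inner_curvature_swap hE hZ hX hY hT hx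
  have t4 := hcov.inner_curvature_swap hE hZ hT hX hY hx
  have t5 := hcov.inner_curvature_swap hE hT hY hX hZ hx
  have t6 := hcov.inner_curvature_swap hE hT hX hY hZ hx
  have u1 := s1 T Y Z X
  have u2 := s1 T Y X Z
  have u3 := s1 X Z T Y
  have u4 := s1 Z X T Y
  linarith

/-- The sectional curvature of a pair of vector fields only depends on their values. -/
theorem IsLeviCivita.inner_curvature_congr [Nonempty ι] (hcov : IsLeviCivita cov)
    (hE : IsOrthonormalFrameOn E₀ U) {X Y X' Y' : Π x : M, TangentSpace I x}
    (hX : CMDiff[U] ∞ (T% X)) (hY : CMDiff[U] ∞ (T% Y)) (hX' : CMDiff[U] ∞ (T% X'))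
    (hY' : CMDiff[U] ∞ (T% Y')) {x : M} (hx : x ∈ U) (hXX' : X x = X' x) (hYY' : Y x = Y' x) :
    (inner ℝ (cov.curvature X Y Y x) (X x) : ℝ) = inner ℝ (cov.curvature X' Y' Y' x) (X' x) := by
  -- Only the slot outside `cov.curvature` visibly depends on a value alone. The symmetries bring
  -- the other arguments into that slot one at a time, and each is replaced there.
  rw [hXX', hcov.inner_curvature_swap hE hX hY hY hX' hx, hYY',
    hcov.inner_curvature_swap hE hX hY hX' hY' hx, neg_neg,
    hcov.inner_curvature_pair_symm hE hX hY hY' hX' hx, hYY',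
    hcov.inner_curvature_swap hE hY' hX' hX hY' hx, hXX',
    ← hcov.inner_curvature_swap hE hY' hX' hX' hY' hx,
    CovariantDerivative.curvature_swap, inner_neg_left,
    ← hcov.inner_curvature_swap hE hX' hY' hY' hX' hx]

/-- The structure functions `⟨[E_a, E_b], E_c⟩` of a frame. -/
def structureFunction (E₀ : ι → Π x : M, TangentSpace I x) (a b c : ι) (x : M) : ℝ :=
  inner ℝ (mlieBracket I (E₀ a) (E₀ b) x) (E₀ c x)

/-- The connection coefficients `⟨∇_{E_a} E_b, E_c⟩` of an orthonormal frame, in terms of its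
structure functions. -/
def frameConnection (E₀ : ι → Π x : M, TangentSpace I x) (a b c : ι) (x : M) : ℝ :=
  (1 / 2 : ℝ) * (structureFunction E₀ a b c x - structureFunction E₀ b c a x +
    structureFunction E₀ c a b x)

/-- The curvature `⟨R(E_i, E_j) E_j, E_i⟩` of an orthonormal frame, in terms of its structure
functions. -/
def frameCurvature (E₀ : ι → Π x : M, TangentSpace I x) (i j : ι) (x : M) : ℝ :=
  mvfderiv I (frameConnection E₀ j j i) x (E₀ i x) -
    mvfderiv I (frameConnection E₀ i j i) x (E₀ j x) -
    ∑ c, frameConnection E₀ j j c x * frameConnection E₀ i i c x +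
    ∑ c, frameConnection E₀ i j c x * frameConnection E₀ j i c x -
    ∑ c, structureFunction E₀ i j c x * frameConnection E₀ c j i x

theorem structureFunction_swap (E₀ : ι → Π x : M, TangentSpace I x) (a b c : ι) (x : M) :
    structureFunction E₀ a b c x = -structureFunction E₀ b a c x := by
  simp only [structureFunction]
  rw [mlieBracket_swap_apply, inner_neg_left]

/-- Inner products of frame fields are constant, so only the bracket terms of the Koszul formula
survive. -/
theorem IsLeviCivita.inner_cov_frame (hcov : IsLeviCivita cov) (hE : IsOrthonormalFrameOn E₀ U)
    {x : M} (hx : x ∈ U) (a b c : ι) :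
    (inner ℝ (cov (E₀ b) x (E₀ a x)) (E₀ c x) : ℝ) = frameConnection E₀ a b c x := by
  have md : ∀ a, MDiffAt (T% (E₀ a)) x :=
    fun a => (hE.smooth a).mdifferentiableAt_of_isOpen hE.isOpen hx
  rw [hcov.koszul (md a) (md b) (md c), hE.mvfderiv_inner hx, hE.mvfderiv_inner hx,
    hE.mvfderiv_inner hx, frameConnection, structureFunction_swap E₀ c a b]
  simp only [structureFunction, zero_apply]
  ring

theorem IsOrthonormalFrameOn.contMDiffOn_structureFunction (hE : IsOrthonormalFrameOn E₀ U)
    (a b c : ι) : CMDiff[U] ∞ (structureFunction E₀ a b c) :=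
  ((hE.smooth a).mlieBracket_of_isOpen hE.isOpen (hE.smooth b)).inner_tangent (hE.smooth c)

theorem IsOrthonormalFrameOn.contMDiffOn_frameConnection (hE : IsOrthonormalFrameOn E₀ U)
    (a b c : ι) : CMDiff[U] ∞ (frameConnection E₀ a b c) :=
  contMDiffOn_const.mul
    (((hE.contMDiffOn_structureFunction a b c).sub (hE.contMDiffOn_structureFunction b c a)).add
      (hE.contMDiffOn_structureFunction c a b))

/-- Metric compatibility turns `⟨∇_{E_b} ∇_{E_a} E_j, E_i⟩` into the derivative of a connection
coefficient minus `⟨∇_{E_a} E_j, ∇_{E_b} E_i⟩`, which is expanded in the frame. -/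
theorem IsLeviCivita.frameCurvature_eq (hcov : IsLeviCivita cov) (hE : IsOrthonormalFrameOn E₀ U)
    {x : M} (hx : x ∈ U) (i j : ι) :
    frameCurvature E₀ i j x = inner ℝ (cov.curvature (E₀ i) (E₀ j) (E₀ j) x) (E₀ i x) := by
  have hU := hE.isOpen
  have md : ∀ {W : Π x : M, TangentSpace I x}, CMDiff[U] ∞ (T% W) → MDiffAt (T% W) x :=
    fun hW => hW.mdifferentiableAt_of_isOpen hU hx
  have h1 : ∀ a b, (inner ℝ (cov (fun y => cov (E₀ j) y (E₀ a y)) x (E₀ b x)) (E₀ i x) : ℝ) =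
      mvfderiv I (frameConnection E₀ a j i) x (E₀ b x) -
        ∑ c, frameConnection E₀ a j c x * frameConnection E₀ b i c x := by
    intro a b
    have h2 : frameConnection E₀ a j i =ᶠ[𝓝 x]
        fun y => (inner ℝ (cov (E₀ j) y (E₀ a y)) (E₀ i y) : ℝ) := by
      filter_upwards [hU.mem_nhds hx] with y hy
      exact (hcov.inner_cov_frame hE hy a j i).symm
    rw [mvfderiv_congr_of_eventuallyEq h2, hcov.mvfderiv_inner _
      (md (hcov.contMDiffOn_cov hE (hE.smooth a) (hE.smooth j))) (md (hE.smooth i)),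
      hE.inner_eq_sum hx (cov (E₀ j) x (E₀ a x))]
    simp only [hcov.inner_cov_frame hE hx]
    ring
  have h3 : (inner ℝ (cov (E₀ j) x (mlieBracket I (E₀ i) (E₀ j) x)) (E₀ i x) : ℝ) =
      ∑ c, structureFunction E₀ i j c x * frameConnection E₀ c j i x := by
    conv_lhs => rw [← hE.sum_inner_smul x hx (mlieBracket I (E₀ i) (E₀ j) x), map_sum, sum_inner]
    refine Finset.sum_congr rfl fun c _ => ?_
    rw [map_smul, inner_smul_left, hcov.inner_cov_frame hE hx, real_inner_comm]
    rfl
  simp only [CovariantDerivative.curvature, inner_sub_left]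
  rw [h1, h1, h3, frameCurvature]
  ring

/-- Orthonormal frames which agree at a point have the same curvature there. -/
theorem IsLeviCivita.frameCurvature_congr (hcov : IsLeviCivita cov)
    {E₁ : ι → Π x : M, TangentSpace I x} {U₁ : Set M} (hE : IsOrthonormalFrameOn E₀ U)
    (hE₁ : IsOrthonormalFrameOn E₁ U₁) {x : M} (hx : x ∈ U) (hx₁ : x ∈ U₁)
    (h : ∀ a, E₀ a x = E₁ a x) (i j : ι) :
    frameCurvature E₀ i j x = frameCurvature E₁ i j x := by
  have hF : IsOrthonormalFrameOn E₀ (U ∩ U₁) :=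
    { isOpen := hE.isOpen.inter hE₁.isOpen
      smooth := fun a => (hE.smooth a).mono inter_subset_left
      orthonormal := fun y hy => hE.orthonormal y hy.1
      sum_inner_smul := fun y hy => hE.sum_inner_smul y hy.1 }
  have : Nonempty ι := ⟨i⟩
  rw [hcov.frameCurvature_eq hE hx, hcov.frameCurvature_eq hE₁ hx₁]
  exact hcov.inner_curvature_congr hF (hF.smooth i) (hF.smooth j)
    ((hE₁.smooth i).mono inter_subset_right) ((hE₁.smooth j).mono inter_subset_right) ⟨hx, hx₁⟩
    (h i) (h j)

end Curvature

/-! ### Naturality under local isometries and constancy of sectional curvature -/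

noncomputable section Naturality

open VectorField

variable {E : Type*} [NormedAddCommGroup E] [NormedSpace ℝ E] [FiniteDimensional ℝ E]
  [CompleteSpace E]
  {H : Type*} [TopologicalSpace H] {I : ModelWithCorners ℝ E H}
  {M : Type*} [TopologicalSpace M] [ChartedSpace H M] [IsManifold I ∞ M]
  [RiemannianBundle (fun x : M => TangentSpace I x)]
  [IsContMDiffRiemannianBundle I ∞ E (fun x : M => TangentSpace I x)]
  {cov : CovariantDerivative I E (fun x : M => TangentSpace I x)}
  {ι : Type*} [Fintype ι] {E₀ : ι → Π x : M, TangentSpace I x} {U : Set M}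
  {φ : OpenPartialHomeomorph M M}

theorem IsLocalIsometry.isInvertible_mfderiv (hφ : IsLocalIsometry I φ) {x : M}
    (hx : x ∈ φ.source) : (mfderiv I I φ x).IsInvertible := by
  have h : φ.MDifferentiable I I :=
    ⟨hφ.contMDiffOn.mdifferentiableOn (by simp), hφ.contMDiffOn_symm.mdifferentiableOn (by simp)⟩
  exact ⟨h.mfderiv hx, rfl⟩

theorem IsLocalIsometry.mfderiv_mpullback (hφ : IsLocalIsometry I φ)
    (X : Π x : M, TangentSpace I x) {x : M} (hx : x ∈ φ.source) :
    mfderiv I I φ x (mpullback I I φ X x) = X (φ x) := by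
  obtain ⟨e, he⟩ := hφ.isInvertible_mfderiv hx
  rw [mpullback_apply, ← he, ContinuousLinearMap.inverse_equiv]
  exact e.apply_symm_apply _

theorem IsLocalIsometry.inner_mpullback (hφ : IsLocalIsometry I φ)
    (X Y : Π x : M, TangentSpace I x) {x : M} (hx : x ∈ φ.source) :
    (inner ℝ (mpullback I I φ X x) (mpullback I I φ Y x) : ℝ) = inner ℝ (X (φ x)) (Y (φ x)) := by
  rw [← hφ.inner_mfderiv x hx, hφ.mfderiv_mpullback X hx, hφ.mfderiv_mpullback Y hx]

theorem IsLocalIsometry.contMDiffAt (hφ : IsLocalIsometry I φ) {x : M} (hx : x ∈ φ.source) :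
    ContMDiffAt I I ∞ φ x :=
  hφ.contMDiffOn.contMDiffAt (φ.open_source.mem_nhds hx)

/-- The pull-back of an orthonormal frame by a local isometry. -/
theorem IsOrthonormalFrameOn.mpullback (hE : IsOrthonormalFrameOn E₀ U)
    (hφ : IsLocalIsometry I φ) :
    IsOrthonormalFrameOn (fun a => mpullback I I φ (E₀ a)) (φ.source ∩ φ ⁻¹' U) where
  isOpen := φ.isOpen_inter_preimage hE.isOpen
  smooth a x hx := (ContMDiffAt.mpullback_vectorField_preimage (n := ∞)
    ((hE.smooth a).contMDiffAt (hE.isOpen.mem_nhds hx.2)) (hφ.contMDiffAt hx.1)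
    (hφ.isInvertible_mfderiv hx.1) (by simp)).contMDiffWithinAt
  orthonormal x hx := by
    classical
    rw [orthonormal_iff_ite]
    intro a b
    rw [hφ.inner_mpullback _ _ hx.1]
    exact orthonormal_iff_ite.1 (hE.orthonormal _ hx.2) a b
  sum_inner_smul x hx v := by
    apply (hφ.isInvertible_mfderiv hx.1).injective
    rw [map_sum, ← hE.sum_inner_smul _ hx.2 (mfderiv I I φ x v)]
    refine Finset.sum_congr rfl fun a _ => ?_
    rw [map_smul, ← hφ.inner_mfderiv x hx.1, hφ.mfderiv_mpullback _ hx.1]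

theorem IsOrthonormalFrameOn.structureFunction_mpullback (hE : IsOrthonormalFrameOn E₀ U)
    (hφ : IsLocalIsometry I φ) {x : M} (hx : x ∈ φ.source ∩ φ ⁻¹' U) (a b c : ι) :
    structureFunction (fun a => VectorField.mpullback I I φ (E₀ a)) a b c x =
      structureFunction E₀ a b c (φ x) := by
  have : IsManifold I (minSmoothness ℝ 3) M := by
    rw [minSmoothness_of_isRCLikeNormedField]
    exact IsManifold.of_le (n := ∞) ENat.LEInfty.out
  have md : ∀ a, MDiffAt (T% (E₀ a)) (φ x) :=
    fun a => (hE.smooth a).mdifferentiableAt_of_isOpen hE.isOpen hx.2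
  rw [structureFunction, ← mpullback_mlieBracket (md a) (md b) (hφ.contMDiffAt hx.1)
    (by rw [minSmoothness_of_isRCLikeNormedField]; exact ENat.LEInfty.out),
    hφ.inner_mpullback _ _ hx.1, structureFunction]

theorem IsOrthonormalFrameOn.frameConnection_mpullback (hE : IsOrthonormalFrameOn E₀ U)
    (hφ : IsLocalIsometry I φ) {x : M} (hx : x ∈ φ.source ∩ φ ⁻¹' U) (a b c : ι) :
    frameConnection (fun a => VectorField.mpullback I I φ (E₀ a)) a b c x =
      frameConnection E₀ a b c (φ x) := by
  simp only [frameConnection, hE.structureFunction_mpullback hφ hx]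

/-- Brackets and inner products commute with the pull-back, and derivatives along the frame follow
by the chain rule; no naturality of `cov` is needed. -/
theorem IsOrthonormalFrameOn.frameCurvature_mpullback (hE : IsOrthonormalFrameOn E₀ U)
    (hφ : IsLocalIsometry I φ) {x : M} (hx : x ∈ φ.source ∩ φ ⁻¹' U) (i j : ι) :
    frameCurvature (fun a => VectorField.mpullback I I φ (E₀ a)) i j x =
      frameCurvature E₀ i j (φ x) := by
  have hd : ∀ a b c d, mvfderiv I
      (frameConnection (fun a => VectorField.mpullback I I φ (E₀ a)) a b c) x
        (VectorField.mpullback I I φ (E₀ d) x) =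
      mvfderiv I (frameConnection E₀ a b c) (φ x) (E₀ d (φ x)) := by
    intro a b c d
    have h1 : frameConnection (fun a => VectorField.mpullback I I φ (E₀ a)) a b c =ᶠ[𝓝 x]
        frameConnection E₀ a b c ∘ φ := by
      filter_upwards [(φ.isOpen_inter_preimage hE.isOpen).mem_nhds hx] with y hy
      exact hE.frameConnection_mpullback hφ hy a b c
    rw [mvfderiv_congr_of_eventuallyEq h1, mvfderiv_comp_apply x
      (((hE.contMDiffOn_frameConnection a b c).contMDiffAt
        (hE.isOpen.mem_nhds hx.2)).mdifferentiableAt (by simp))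
      ((hφ.contMDiffAt hx.1).mdifferentiableAt (by simp)), hφ.mfderiv_mpullback _ hx.1]
  simp only [frameCurvature, hd, hE.frameConnection_mpullback hφ hx,
    hE.structureFunction_mpullback hφ hx]

/-- In a locally homogeneous geometry with full isotropy, the sectional curvatures of an
orthonormal frame are constant. -/
theorem IsLocallyHomogeneousGeometry.frameCurvature_eq (hM : IsLocallyHomogeneousGeometry I M)
    (hcov : IsLeviCivita cov) (hE : IsOrthonormalFrameOn E₀ U) {p q : M} (hp : p ∈ U) (hq : q ∈ U)
    (i j : ι) : frameCurvature E₀ i j p = frameCurvature E₀ i j q := by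
  have hspan : ∀ x ∈ U, ⊤ ≤ Submodule.span ℝ (range fun a => E₀ a x) := by
    intro x hx v _
    rw [← hE.sum_inner_smul x hx v]
    exact Submodule.sum_mem _ fun a _ =>
      Submodule.smul_mem _ _ (Submodule.subset_span (mem_range_self a))
  let bp := OrthonormalBasis.mk (hE.orthonormal p hp) (hspan p hp)
  let bq := OrthonormalBasis.mk (hE.orthonormal q hq) (hspan q hq)
  let L := bp.equiv bq (Equiv.refl ι)
  have hL : ∀ a, L (E₀ a p) = E₀ a q := by
    intro a
    have := bp.equiv_apply_basis bq (Equiv.refl ι) a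
    simpa [bp, bq, L] using this
  obtain ⟨φ, hφ, hpφ, h⟩ := hM p q L
  -- The fibres over `φ p` and `q` are different types until `φ p = q` is used; stating the equality
  -- for a point of the total space avoids a cast.
  have hz : ∀ (a : ι) (z : TangentBundle I M), z = ⟨q, E₀ a q⟩ → z.2 = E₀ a z.1 := by
    rintro a _ rfl
    rfl
  have h1 : φ p = q := congrArg TotalSpace.proj (h 0)
  have h2 : ∀ a, mfderiv I I φ p (E₀ a p) = E₀ a (φ p) := by
    intro a
    have := h (E₀ a p)
    rw [hL] at this
    exact hz a _ this
  have hx : p ∈ φ.source ∩ φ ⁻¹' U := ⟨hpφ, by rw [mem_preimage, h1]; exact hq⟩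
  -- The frame and its pull-back by `φ` agree at `p`, though perhaps nowhere else, and that is
  -- enough for equal curvature at `p`.
  rw [hcov.frameCurvature_congr hE (hE.mpullback hφ) hp hx (fun a => ?_),
    hE.frameCurvature_mpullback hφ hx, h1]
  apply (hφ.isInvertible_mfderiv hpφ).injective
  rw [h2, hφ.mfderiv_mpullback _ hpφ]

end Naturality

/-! ### Orthonormal families of full cardinality -/

section LinearAlgebra

theorem Orthonormal.sum_inner_smul_of_card_eq_finrank {ι T : Type*} [Fintype ι]
    [NormedAddCommGroup T] [InnerProductSpace ℝ T] [FiniteDimensional ℝ T] {b : ι → T}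
    (hb : Orthonormal ℝ b) (hc : Fintype.card ι = Module.finrank ℝ T) (v : T) :
    ∑ a, (inner ℝ (b a) v : ℝ) • b a = v := by
  have h := (hb.linearIndependent.span_eq_top_of_card_eq_finrank' hc).ge
  simpa using (OrthonormalBasis.mk hb h).sum_repr' v

end LinearAlgebra

/-! ### The adapted frame and O'Neill's formula -/

noncomputable section AdaptedFrame

open VectorField

variable {n : ℕ}
  {M : Type*} [TopologicalSpace M] [ChartedSpace (EuclideanSpace ℝ (Fin (n + 1))) M]
  [IsManifold (𝓡 (n + 1)) ∞ M]
  [RiemannianBundle (fun x : M => TangentSpace (𝓡 (n + 1)) x)]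
  [IsContMDiffRiemannianBundle (𝓡 (n + 1)) ∞ (EuclideanSpace ℝ (Fin (n + 1)))
    (fun x : M => TangentSpace (𝓡 (n + 1)) x)]
  {N : Type*} [TopologicalSpace N] [ChartedSpace (EuclideanSpace ℝ (Fin n)) N]
  [IsManifold (𝓡 n) ∞ N]
  [RiemannianBundle (fun y : N => TangentSpace (𝓡 n) y)]
  [IsContMDiffRiemannianBundle (𝓡 n) ∞ (EuclideanSpace ℝ (Fin n))
    (fun y : N => TangentSpace (𝓡 n) y)]
  {pr : M → N} {U : Set M} {W : Set N}
  {ebar : Fin n → (y : N) → TangentSpace (𝓡 n) y}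
  {e : Fin n → (x : M) → TangentSpace (𝓡 (n + 1)) x}
  {V : (x : M) → TangentSpace (𝓡 (n + 1)) x}
  {cov : CovariantDerivative (𝓡 (n + 1)) (EuclideanSpace ℝ (Fin (n + 1)))
      (fun x : M => TangentSpace (𝓡 (n + 1)) x)}

theorem finrank_tangentSpace_euclidean {m : ℕ} {P : Type*} [TopologicalSpace P]
    [ChartedSpace (EuclideanSpace ℝ (Fin m)) P] (x : P) :
    Module.finrank ℝ (TangentSpace (𝓡 m) x) = m :=
  finrank_euclideanSpace_fin (𝕜 := ℝ)

instance finiteDimensional_tangentSpace_euclidean {m : ℕ} {P : Type*} [TopologicalSpace P]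
    [ChartedSpace (EuclideanSpace ℝ (Fin m)) P] (x : P) :
    FiniteDimensional ℝ (TangentSpace (𝓡 m) x) :=
  inferInstanceAs (FiniteDimensional ℝ (EuclideanSpace ℝ (Fin m)))

theorem IsAdaptedFrame.isOrthonormalFrameOn_base (h : IsAdaptedFrame pr U W ebar e V) :
    IsOrthonormalFrameOn ebar W where
  isOpen := h.isOpen_base
  smooth := h.smooth_base
  orthonormal := h.orthonormal_base
  sum_inner_smul y hy v := (h.orthonormal_base y hy).sum_inner_smul_of_card_eq_finrank
    (by rw [finrank_tangentSpace_euclidean, Fintype.card_fin]) v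

theorem IsAdaptedFrame.vertical_ne_zero (h : IsAdaptedFrame pr U W ebar e V) {x : M}
    (hx : x ∈ U) : V x ≠ 0 := by
  intro h0
  have := h.norm_vertical x hx
  rw [h0, norm_zero] at this
  exact zero_ne_one this

/-- The differential is onto because it hits the frame `ē`, so by rank-nullity its kernel is a line,
spanned by `V x`. -/
theorem IsAdaptedFrame.exists_smul_vertical (h : IsAdaptedFrame pr U W ebar e V) {x : M}
    (hx : x ∈ U) {w : TangentSpace (𝓡 (n + 1)) x}
    (hw : mfderiv (𝓡 (n + 1)) (𝓡 n) pr x w = 0) : ∃ c : ℝ, c • V x = w := by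
  let A : TangentSpace (𝓡 (n + 1)) x →ₗ[ℝ] TangentSpace (𝓡 n) (pr x) :=
    (mfderiv (𝓡 (n + 1)) (𝓡 n) pr x).toLinearMap
  have hsurj : LinearMap.range A = ⊤ := by
    rw [eq_top_iff]
    intro u _
    rw [← h.isOrthonormalFrameOn_base.sum_inner_smul _ (h.mapsTo hx) u]
    exact Submodule.sum_mem _ fun a _ => Submodule.smul_mem _ _ ⟨e a x, h.lift x hx a⟩
  have hrank := A.finrank_range_add_finrank_ker
  rw [hsurj, finrank_top, finrank_tangentSpace_euclidean, finrank_tangentSpace_euclidean] at hrank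
  have h1 : Module.finrank ℝ (LinearMap.ker A) = 1 := by omega
  have hV : (⟨V x, h.vertical x hx⟩ : LinearMap.ker A) ≠ 0 := fun h0 =>
    h.vertical_ne_zero hx (congrArg Subtype.val h0)
  obtain ⟨c, hc⟩ := (finrank_eq_one_iff_of_nonzero' _ hV).1 h1 ⟨w, hw⟩
  exact ⟨c, congrArg Subtype.val hc⟩

/-- Polarization of the norm condition on horizontal vectors. -/
theorem IsRiemannianSubmersion.inner_mfderiv
    (hpr : IsRiemannianSubmersion (𝓡 (n + 1)) (𝓡 n) pr) {x : M}
    {v w : TangentSpace (𝓡 (n + 1)) x}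
    (hv : ∀ u, mfderiv (𝓡 (n + 1)) (𝓡 n) pr x u = 0 → (inner ℝ v u : ℝ) = 0)
    (hw : ∀ u, mfderiv (𝓡 (n + 1)) (𝓡 n) pr x u = 0 → (inner ℝ w u : ℝ) = 0) :
    (inner ℝ (mfderiv (𝓡 (n + 1)) (𝓡 n) pr x v) (mfderiv (𝓡 (n + 1)) (𝓡 n) pr x w) : ℝ) =
      inner ℝ v w := by
  have hvw := hpr.norm_mfderiv x (v + w) fun u hu => by
    rw [inner_add_left, hv u hu, hw u hu, add_zero]
  rw [map_add] at hvw
  rw [real_inner_eq_norm_add_mul_self_sub_norm_mul_self_sub_norm_mul_self_div_two,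
    real_inner_eq_norm_add_mul_self_sub_norm_mul_self_sub_norm_mul_self_div_two,
    hvw, hpr.norm_mfderiv x v hv, hpr.norm_mfderiv x w hw]

/-- The frame `(V, e₁, …, eₙ)`. -/
def adaptedFrame (e : Fin n → (x : M) → TangentSpace (𝓡 (n + 1)) x)
    (V : (x : M) → TangentSpace (𝓡 (n + 1)) x) :
    Fin (n + 1) → (x : M) → TangentSpace (𝓡 (n + 1)) x :=
  fun a => Fin.cases V e a

@[simp] theorem adaptedFrame_zero : adaptedFrame e V 0 = V := rfl

@[simp] theorem adaptedFrame_succ (i : Fin n) : adaptedFrame e V i.succ = e i := rfl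

theorem IsAdaptedFrame.isOrthonormalFrameOn (h : IsAdaptedFrame pr U W ebar e V)
    (hpr : IsRiemannianSubmersion (𝓡 (n + 1)) (𝓡 n) pr) :
    IsOrthonormalFrameOn (adaptedFrame e V) U := by
  have horth : ∀ x ∈ U, Orthonormal ℝ fun a => adaptedFrame e V a x := by
    intro x hx
    have hhor : ∀ i, ∀ u, mfderiv (𝓡 (n + 1)) (𝓡 n) pr x u = 0 → (inner ℝ (e i x) u : ℝ) = 0 := by
      intro i u hu
      obtain ⟨c, rfl⟩ := h.exists_smul_vertical hx hu
      rw [inner_smul_right, h.horizontal x hx i, mul_zero]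
    rw [orthonormal_iff_ite]
    intro a b
    refine Fin.cases ?_ (fun i => ?_) a <;> refine Fin.cases ?_ (fun j => ?_) b
    · simp [h.norm_vertical x hx]
    · simp [real_inner_comm, h.horizontal x hx j, (Fin.succ_ne_zero j).symm]
    · simp [h.horizontal x hx i]
    · have := orthonormal_iff_ite.1 (h.orthonormal_base _ (h.mapsTo hx)) i j
      rw [← h.lift x hx, ← h.lift x hx, hpr.inner_mfderiv (hhor i) (hhor j)] at this
      simpa using this
  exact
  { isOpen := h.isOpen_source
    smooth := fun a => Fin.cases h.smooth_vertical h.smooth_horizontal a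
    orthonormal := horth
    sum_inner_smul := fun x hx v => (horth x hx).sum_inner_smul_of_card_eq_finrank
      (by rw [finrank_tangentSpace_euclidean, Fintype.card_fin]) v }

theorem IsAdaptedFrame.inner_mfderiv (h : IsAdaptedFrame pr U W ebar e V)
    (hpr : IsRiemannianSubmersion (𝓡 (n + 1)) (𝓡 n) pr) {x : M} (hx : x ∈ U)
    (v : TangentSpace (𝓡 (n + 1)) x) (k : Fin n) :
    (inner ℝ v (e k x) : ℝ) = inner ℝ (mfderiv (𝓡 (n + 1)) (𝓡 n) pr x v) (ebar k (pr x)) := by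
  have h1 := (h.isOrthonormalFrameOn hpr).sum_inner_smul x hx v
  rw [Fin.sum_univ_succ] at h1
  simp only [adaptedFrame_zero, adaptedFrame_succ] at h1
  conv_rhs => rw [← h1]
  rw [map_add, map_smul, h.vertical x hx, smul_zero, zero_add, map_sum]
  simp only [map_smul, h.lift x hx]
  rw [real_inner_comm (ebar k (pr x)), (h.orthonormal_base _ (h.mapsTo hx)).inner_right_fintype, real_inner_comm]

theorem IsAdaptedFrame.structureFunction_succ (h : IsAdaptedFrame pr U W ebar e V)
    (hpr : IsRiemannianSubmersion (𝓡 (n + 1)) (𝓡 n) pr) {x : M} (hx : x ∈ U) (i j k : Fin n) :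
    structureFunction (adaptedFrame e V) i.succ j.succ k.succ x =
      structureFunction ebar i j k (pr x) := by
  simp only [structureFunction, adaptedFrame_succ]
  rw [h.inner_mfderiv hpr hx, mfderiv_mlieBracket_of_related h.isOpen_source h.isOpen_base
    hpr.isSubmersion.contMDiff.contMDiffOn h.mapsTo (h.smooth_horizontal i) (h.smooth_horizontal j)
    h.smooth_vertical (h.smooth_base i) (h.smooth_base j) (h.smooth_base i)
    (fun y hy => h.lift y hy i) (fun y hy => h.lift y hy j) hx (h.vertical_ne_zero hx)
    (h.isOrthonormalFrameOn_base.ne_zero (h.mapsTo hx) i)]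

/-- `V` is related to the zero field, so `[eᵢ, V]` is related to `[ēᵢ, 0] = 0` and has no horizontal
part. -/
theorem IsAdaptedFrame.structureFunction_zero (h : IsAdaptedFrame pr U W ebar e V)
    (hpr : IsRiemannianSubmersion (𝓡 (n + 1)) (𝓡 n) pr) {x : M} (hx : x ∈ U) (i k : Fin n) :
    structureFunction (adaptedFrame e V) i.succ 0 k.succ x = 0 := by
  simp only [structureFunction, adaptedFrame_succ, adaptedFrame_zero]
  have h0 : ContMDiffOn (𝓡 n) (𝓡 n).tangent ∞
      (fun y => (⟨y, (0 : (y : N) → TangentSpace (𝓡 n) y) y⟩ : TangentBundle (𝓡 n) N)) W :=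
    (contMDiff_zeroSection ℝ (fun y : N => TangentSpace (𝓡 n) y)).contMDiffOn
  rw [h.inner_mfderiv hpr hx, mfderiv_mlieBracket_of_related h.isOpen_source h.isOpen_base
    hpr.isSubmersion.contMDiff.contMDiffOn h.mapsTo (h.smooth_horizontal i) h.smooth_vertical
    h.smooth_vertical (h.smooth_base i) h0 (h.smooth_base i)
    (fun y hy => h.lift y hy i) (fun y hy => h.vertical y hy) hx (h.vertical_ne_zero hx)
    (h.isOrthonormalFrameOn_base.ne_zero (h.mapsTo hx) i), mlieBracket_zero_right, Pi.zero_apply,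
    inner_zero_left]

theorem IsAdaptedFrame.frameConnection_succ (h : IsAdaptedFrame pr U W ebar e V)
    (hpr : IsRiemannianSubmersion (𝓡 (n + 1)) (𝓡 n) pr) {x : M} (hx : x ∈ U) (i j k : Fin n) :
    frameConnection (adaptedFrame e V) i.succ j.succ k.succ x = frameConnection ebar i j k (pr x) := by
  simp only [frameConnection, h.structureFunction_succ hpr hx]

theorem IsAdaptedFrame.frameConnection_horizontal_vertical (h : IsAdaptedFrame pr U W ebar e V)
    (hpr : IsRiemannianSubmersion (𝓡 (n + 1)) (𝓡 n) pr) {x : M} (hx : x ∈ U) (i j : Fin n) :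
    frameConnection (adaptedFrame e V) i.succ j.succ 0 x =
      (1 / 2) * structureFunction (adaptedFrame e V) i.succ j.succ 0 x := by
  rw [frameConnection, h.structureFunction_zero hpr hx, structureFunction_swap _ 0 i.succ,
    h.structureFunction_zero hpr hx]
  ring

theorem IsAdaptedFrame.frameConnection_vertical (h : IsAdaptedFrame pr U W ebar e V)
    (hpr : IsRiemannianSubmersion (𝓡 (n + 1)) (𝓡 n) pr) {x : M} (hx : x ∈ U) (i j : Fin n) :
    frameConnection (adaptedFrame e V) 0 j.succ i.succ x =
      (1 / 2) * structureFunction (adaptedFrame e V) i.succ j.succ 0 x := by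
  rw [frameConnection, h.structureFunction_zero hpr hx, structureFunction_swap _ 0 j.succ,
    h.structureFunction_zero hpr hx, structureFunction_swap _ j.succ i.succ]
  ring

/-- O'Neill's formula for the curvature of the adapted frame. -/
theorem IsAdaptedFrame.frameCurvature_eq (h : IsAdaptedFrame pr U W ebar e V)
    (hpr : IsRiemannianSubmersion (𝓡 (n + 1)) (𝓡 n) pr) {x : M} (hx : x ∈ U) (i j : Fin n) :
    frameCurvature (adaptedFrame e V) i.succ j.succ x = frameCurvature ebar i j (pr x) -
      (3 / 4) * structureFunction (adaptedFrame e V) j.succ i.succ 0 x ^ 2 := by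
  have hd : ∀ a b c d : Fin n, mvfderiv (𝓡 (n + 1))
      (frameConnection (adaptedFrame e V) a.succ b.succ c.succ) x (e d x) =
      mvfderiv (𝓡 n) (frameConnection ebar a b c) (pr x) (ebar d (pr x)) := by
    intro a b c d
    have h1 : frameConnection (adaptedFrame e V) a.succ b.succ c.succ =ᶠ[𝓝 x]
        frameConnection ebar a b c ∘ pr := by
      filter_upwards [h.isOpen_source.mem_nhds hx] with y hy
      exact h.frameConnection_succ hpr hy a b c
    rw [mvfderiv_congr_of_eventuallyEq h1, mvfderiv_comp_apply x
      (((h.isOrthonormalFrameOn_base.contMDiffOn_frameConnection a b c).contMDiffAt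
        (h.isOpen_base.mem_nhds (h.mapsTo hx))).mdifferentiableAt (by simp))
      (hpr.isSubmersion.contMDiff.mdifferentiableAt (by simp)), h.lift x hx]
  have hself : ∀ a : Fin n, structureFunction (adaptedFrame e V) a.succ a.succ 0 x = 0 := by
    intro a
    have := structureFunction_swap (adaptedFrame e V) a.succ a.succ 0 x
    linarith
  -- The horizontal terms reproduce the curvature of `ē`. With `s = ⟨[eᵢ, e_j], V⟩`, the vertical
  -- index contributes `0`, `-s²/4` and `-s²/2` in the three sums, whence the constant `3/4`.
  simp only [frameCurvature, adaptedFrame_succ, hd, Fin.sum_univ_succ, h.frameConnection_succ hpr hx,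
    h.structureFunction_succ hpr hx, h.frameConnection_horizontal_vertical hpr hx,
    h.frameConnection_vertical hpr hx, hself]
  rw [structureFunction_swap (adaptedFrame e V) i.succ j.succ 0 x]
  ring

theorem IsAdaptedFrame.rotationFunction_eq (h : IsAdaptedFrame pr U W ebar e V)
    (hpr : IsRiemannianSubmersion (𝓡 (n + 1)) (𝓡 n) pr) (hcov : IsLeviCivita cov) {x : M} (hx : x ∈ U)
    (i j : Fin n) : rotationFunction cov e V i j x =
      (1 / 2) * structureFunction (adaptedFrame e V) j.succ i.succ 0 x := by
  rw [← h.frameConnection_horizontal_vertical hpr hx,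
    ← hcov.inner_cov_frame (h.isOrthonormalFrameOn hpr) hx]
  rfl

theorem IsAdaptedFrame.contMDiffOn_rotationFunction (h : IsAdaptedFrame pr U W ebar e V)
    (hpr : IsRiemannianSubmersion (𝓡 (n + 1)) (𝓡 n) pr) (hcov : IsLeviCivita cov) (i j : Fin n) :
    ContMDiffOn (𝓡 (n + 1)) 𝓘(ℝ, ℝ) ∞ (rotationFunction cov e V i j) U :=
  (contMDiffOn_const.mul
    ((h.isOrthonormalFrameOn hpr).contMDiffOn_structureFunction j.succ i.succ 0)).congr
    fun _ hx => h.rotationFunction_eq hpr hcov hx i j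

/-- In a locally homogeneous geometry with full isotropy, the squares of the rotation functions are
constant on the fibres. -/
theorem IsAdaptedFrame.rotationFunction_sq_eq (h : IsAdaptedFrame pr U W ebar e V)
    (hpr : IsRiemannianSubmersion (𝓡 (n + 1)) (𝓡 n) pr) (hM : IsLocallyHomogeneousGeometry (𝓡 (n + 1)) M)
    (hcov : IsLeviCivita cov) {x x' : M} (hx : x ∈ U) (hx' : x' ∈ U) (hxx' : pr x = pr x')
    (i j : Fin n) :
    rotationFunction cov e V i j x ^ 2 = rotationFunction cov e V i j x' ^ 2 := by
  have h1 := hM.frameCurvature_eq hcov (h.isOrthonormalFrameOn hpr) hx hx' i.succ j.succ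
  rw [h.frameCurvature_eq hpr hx, h.frameCurvature_eq hpr hx', hxx'] at h1
  rw [h.rotationFunction_eq hpr hcov hx, h.rotationFunction_eq hpr hcov hx']
  linarith

end AdaptedFrame

/-! ### From constant squares to constancy along leaves and basic functions -/

section Leaves

/-- The image is a connected subset of the finite set `{f x, -f x}`, hence a single point. -/
theorem IsPreconnected.eq_of_sq_eq_sq {X : Type*} [TopologicalSpace X] {S : Set X}
    (hS : IsPreconnected S) {f : X → ℝ} (hf : ContinuousOn f S)
    (h : ∀ x ∈ S, ∀ x' ∈ S, f x ^ 2 = f x' ^ 2) : ∀ x ∈ S, ∀ x' ∈ S, f x = f x' := by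
  intro x hx x' hx'
  have hsub : f '' S ⊆ {f x, -f x} := by
    rintro _ ⟨y, hy, rfl⟩
    exact sq_eq_sq_iff_eq_or_eq_neg.1 (h y hy x hx)
  have hT : IsTotallyDisconnected ({f x, -f x} : Set ℝ) :=
    (toFinite ({f x, -f x} : Set ℝ)).countable.isTotallyDisconnected
  exact hT _ hsub (hS.image f hf) (mem_image_of_mem f hx) (mem_image_of_mem f hx')

/-- A smooth function which is constant along the leaves of a submersion is locally basic. -/
theorem IsConstantAlongLeaves.isLocallyBasic
    {E : Type*} [NormedAddCommGroup E] [NormedSpace ℝ E]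
    {H : Type*} [TopologicalSpace H] {I : ModelWithCorners ℝ E H} [I.Boundaryless]
    {F : Type*} [NormedAddCommGroup F] [NormedSpace ℝ F]
    {G : Type*} [TopologicalSpace G] {J : ModelWithCorners ℝ F G}
    {M : Type*} [TopologicalSpace M] [ChartedSpace H M] [IsManifold I ∞ M]
    {N : Type*} [TopologicalSpace N] [ChartedSpace G N] [IsManifold J ∞ N]
    {p : M → N} (hp : IsSubmersion I J ∞ p) {U : Set M} (hU : IsOpen U) {f : M → ℝ}
    (hf : ContMDiffOn I 𝓘(ℝ, ℝ) ∞ f U) (h : IsConstantAlongLeaves p U f) :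
    IsLocallyBasic J p U f := by
  intro x hx
  have hs := hp.isSubmersionAt x
  set D := hs.domChart with hD
  set C := hs.codChart with hC
  set A := hs.equiv with hA
  -- `Ψ` parametrizes a neighbourhood of `x` so that, in the chart `C`, the map `p` becomes the
  -- projection to the first factor.
  set Ψ : F × hs.complement → M := fun z => (D.extend I).symm (A.symm z) with hΨ
  set T : Set (F × hs.complement) := A.symm ⁻¹' (D.extend I).target with hT
  have hTo : IsOpen T := D.isOpen_extend_target.preimage A.symm.continuous
  have hΨs : ContMDiffOn 𝓘(ℝ, F × hs.complement) I ∞ Ψ T := by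
    have h1 := contMDiffOn_extend_symm (I := I) hs.domChart_mem_maximalAtlas
    refine h1.comp A.symm.contDiff.contMDiff.contMDiffOn fun z hz => ?_
    rw [I.image_eq]
    rwa [hT, mem_preimage, OpenPartialHomeomorph.extend_target] at hz
  have hleft : ∀ y ∈ D.source, Ψ (A (D.extend I y)) = y := by
    intro y hy
    simp only [hΨ, ContinuousLinearEquiv.symm_apply_apply]
    exact D.extend_left_inv hy
  have hmemT : ∀ y ∈ D.source, A (D.extend I y) ∈ T := by
    intro y hy
    rw [hT, mem_preimage, ContinuousLinearEquiv.symm_apply_apply]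
    exact (D.extend I).map_source (by rwa [D.extend_source])
  have hΨsource : ∀ z ∈ T, Ψ z ∈ D.source := by
    intro z hz
    have := (D.extend I).map_target hz
    rwa [D.extend_source] at this
  have hproj : ∀ z ∈ T, C.extend J (p (Ψ z)) = z.1 := by
    intro z hz
    have := hs.writtenInCharts hz
    exact this.trans (congrArg Prod.fst (A.apply_symm_apply z))
  set O := T ∩ Ψ ⁻¹' U with hO
  have hOo : IsOpen O := hΨs.continuousOn.isOpen_inter_preimage hTo hU
  set z₀ := A (D.extend I x) with hz₀
  have hxD : x ∈ D.source := hs.mem_domChart_source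
  have hz₀O : z₀ ∈ O := ⟨hmemT x hxD, by rw [mem_preimage, hleft x hxD]; exact hx⟩
  -- A box inside the domain, whose second factor is shrunk to a ball to make the plaques `{u} ×ˢ B`
  -- connected.
  obtain ⟨S₁, S₂, hS₁, hzS₁, hS₂, hzS₂, hsub⟩ := mem_nhds_prod_iff'.1 (hOo.mem_nhds hz₀O)
  obtain ⟨r, hr, hball⟩ := Metric.isOpen_iff.1 hS₂ _ hzS₂
  set B := Metric.ball z₀.2 r with hB
  have hbox : S₁ ×ˢ B ⊆ O := (prod_mono_right hball).trans hsub
  have hCD : ∀ y ∈ D.source, C.extend J (p y) = (A (D.extend I y)).1 := by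
    intro y hy
    rw [← hproj _ (hmemT y hy), hleft y hy]
  -- The function on the base is `f` restricted to the transversal through `x` with second
  -- coordinate fixed at `z₀.2`.
  refine ⟨D.source ∩ (A ∘ D.extend I) ⁻¹' (S₁ ×ˢ B), C.source ∩ C.extend J ⁻¹' S₁,
    fun y => f (Ψ (C.extend J y, z₀.2)), ?_, ?_, ?_, ?_, ?_, ?_, ?_⟩
  · exact (A.continuous.comp_continuousOn (D.continuousOn_extend.mono
      (by rw [D.extend_source]))).isOpen_inter_preimage D.open_source
      (hS₁.prod Metric.isOpen_ball)
  · exact ⟨hxD, hzS₁, Metric.mem_ball_self hr⟩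
  · rintro y ⟨hy, hyB⟩
    have := (hbox hyB).2
    rwa [mem_preimage, Function.comp_apply, hleft y hy] at this
  · exact (C.continuousOn_extend.mono (by rw [C.extend_source])).isOpen_inter_preimage
      C.open_source hS₁
  · rintro y ⟨hy, hyB⟩
    refine ⟨hs.source_subset_preimage_source hy, ?_⟩
    rw [mem_preimage, hCD y hy]
    exact hyB.1
  · have hsec : ContMDiffOn J 𝓘(ℝ, F × hs.complement) ∞ (fun y => (C.extend J y, z₀.2))
        (C.source ∩ C.extend J ⁻¹' S₁) :=
      ((OpenPartialHomeomorph.contMDiffOn_extend hs.codChart_mem_maximalAtlas).mono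
        inter_subset_left).prodMk_space contMDiffOn_const
    have hmem : ∀ y ∈ C.source ∩ C.extend J ⁻¹' S₁, (C.extend J y, z₀.2) ∈ O :=
      fun y hy => hbox ⟨hy.2, Metric.mem_ball_self hr⟩
    exact hf.comp (hΨs.comp hsec fun y hy => (hmem y hy).1) fun y hy => (hmem y hy).2
  · rintro y ⟨hy, hyB⟩
    have hu : C.extend J (p y) ∈ S₁ := by
      rw [hCD y hy]
      exact hyB.1
    have hplaque : {C.extend J (p y)} ×ˢ B ⊆ O :=
      (prod_mono_left (singleton_subset_iff.2 hu)).trans hbox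
    -- The plaque through `y` is a connected part of its fibre and meets the transversal, so `f` has
    -- the same value at both points.
    refine h (p y) (Ψ '' ({C.extend J (p y)} ×ˢ B)) ?_ ?_ y ?_ _
      (mem_image_of_mem Ψ ⟨mem_singleton _, Metric.mem_ball_self hr⟩)
    · rintro _ ⟨z, hz, rfl⟩
      refine ⟨(hplaque hz).2, ?_⟩
      apply (C.extend J).injOn
      · rw [C.extend_source]
        exact hs.source_subset_preimage_source (hΨsource z (hplaque hz).1)
      · rw [C.extend_source]
        exact hs.source_subset_preimage_source hy
      · rw [hproj z (hplaque hz).1]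
        exact hz.1
    · exact (isPreconnected_singleton.prod (convex_ball _ _).isPreconnected).image Ψ
        (hΨs.continuousOn.mono fun z hz => (hplaque hz).1)
    · refine ⟨A (D.extend I y), ⟨?_, hyB.2⟩, hleft y hy⟩
      rw [mem_singleton_iff, hCD y hy]

end Leaves

theorem mainTheorem5 (n : ℕ)
    {M : Type*} [TopologicalSpace M] [T2Space M] [SecondCountableTopology M]
    [ChartedSpace (EuclideanSpace ℝ (Fin (n + 1))) M] [IsManifold (𝓡 (n + 1)) ∞ M]
    [RiemannianBundle (fun x : M => TangentSpace (𝓡 (n + 1)) x)]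
    [IsContMDiffRiemannianBundle (𝓡 (n + 1)) ∞ (EuclideanSpace ℝ (Fin (n + 1)))
      (fun x : M => TangentSpace (𝓡 (n + 1)) x)]
    {N : Type*} [TopologicalSpace N] [T2Space N] [SecondCountableTopology N]
    [ChartedSpace (EuclideanSpace ℝ (Fin n)) N] [IsManifold (𝓡 n) ∞ N]
    [RiemannianBundle (fun y : N => TangentSpace (𝓡 n) y)]
    [IsContMDiffRiemannianBundle (𝓡 n) ∞ (EuclideanSpace ℝ (Fin n))
      (fun y : N => TangentSpace (𝓡 n) y)]
    (hM : IsLocallyHomogeneousGeometry (𝓡 (n + 1)) M)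
    (pr : M → N) (hpr : IsRiemannianSubmersion (𝓡 (n + 1)) (𝓡 n) pr)
    (cov : CovariantDerivative (𝓡 (n + 1)) (EuclideanSpace ℝ (Fin (n + 1)))
      (fun x : M => TangentSpace (𝓡 (n + 1)) x))
    (hcov : IsLeviCivita cov)
    (U : Set M) (W : Set N)
    (ebar : Fin n → (y : N) → TangentSpace (𝓡 n) y)
    (e : Fin n → (x : M) → TangentSpace (𝓡 (n + 1)) x)
    (V : (x : M) → TangentSpace (𝓡 (n + 1)) x)
    (hframe : IsAdaptedFrame pr U W ebar e V)
    (i j : Fin n) :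
    IsConstantAlongLeaves pr U (rotationFunction cov e V i j) ∧
      IsLocallyBasic (𝓡 n) pr U (rotationFunction cov e V i j) := by
  have hsmooth := hframe.contMDiffOn_rotationFunction hpr hcov i j
  have hconst : IsConstantAlongLeaves pr U (rotationFunction cov e V i j) := by
    intro y S hS hSc
    refine hSc.eq_of_sq_eq_sq (hsmooth.continuousOn.mono fun x hx => (hS hx).1) fun x hx x' hx' => ?_
    have hxx' : pr x = pr x' := (hS hx).2.trans (hS hx').2.symm
    exact hframe.rotationFunction_sq_eq hpr hM hcov (hS hx).1 (hS hx').1 hxx' i j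
  exact ⟨hconst, hconst.isLocallyBasic hpr.isSubmersion hframe.isOpen_source hsmooth⟩
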